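/- Let $p$ be a prime number, let $n$ be an integer with $p \le n < 2p$, and put $i = n-p$. Let $\mathbb{Z}_{(p)}$ be the localization of $\mathbb{Z}$ at the prime ideal $(p)$, let $S = \mathbb{Z}_{(p)}[x_1,\ldots,x_n]$ with $\deg x_j = 1$ for all $j$, and let the symmetric group $\mathfrak{S}_n$ act on $S$ by permuting the variables. The ring of invariants is the polynomial ring $S^{\mathfrak{S}_n} = \mathbb{Z}_{(p)}[e_1,\ldots,e_n]$, where $e_j$ is the elementary symmetric polynomial of degree $j$ in $x_1,\ldots,x_n$. Let $$S_{\mathfrak{S}_n} = S/\operatorname{span}_{\mathbb{Z}_{(p)}}\{u - g(u) : u \in S,\ g \in \mathfrak{S}_n\}$$ be the cofixed space, a module over $\mathbb{Z}_{(p)}[e_1,\ldots,e_n]$, and let $\operatorname{Tr}: S \to S^{\mathfrak{S}_n}$, $\operatorname{Tr}(f) = \sum_{g \in \mathfrak{S}_n} g(f)$, be the transfer map. Let $I$ be the ideal $$I = \langle p,\ e_1e_p - e_{p+1},\ e_2e_p - e_{p+2},\ \ldots,\ e_ie_p - e_{p+i},\ e_{i+1},\ \ldots,\ e_{p-1}\rangle$$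 of $\mathbb{Z}_{(p)}[e_1,\ldots,e_n]$ (for $0 \le j \le p-1$, its $j$-th listed generator is $p$ if $j = 0$, $e_je_p - e_{p+j}$ if $1 \le j \le i$, and $e_j$ if $i < j \le p-1$). Then: 1. $S_{\mathfrak{S}_n}$ is isomorphic to $I$ as a module over $\mathbb{Z}_{(p)}[e_1,\ldots,e_n]$. 2. $I$ is the image of the transfer map $\operatorname{Tr}$. 3. The listed generators of $I$, in the listed order, form a regular sequence in $\mathbb{Z}_{(p)}[e_1,\ldots,e_n]$. 4. The listed generators are nonzero and homogeneous, with degrees congruent to $0, 1, \ldots, p-1$ modulo $p$, respectively. -/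

import Mathlib

/-- The principal ideal `(p)` of `ℤ` is prime when `p` is a prime number. -/
instance isPrime_span_natCast (p : ℕ) [hp : Fact p.Prime] :
    (Ideal.span {(p : ℤ)}).IsPrime :=
  (Ideal.span_singleton_prime (by exact_mod_cast hp.out.ne_zero)).2
    (Nat.prime_iff_prime_int.1 hp.out)

/-- The ring `ℤ_(p)`, the localization of `ℤ` at the prime ideal `(p)`. -/
abbrev ZLocal (p : ℕ) [Fact p.Prime] : Type :=
  Localization.AtPrime (Ideal.span {(p : ℤ)})

section

open MvPolynomial

/-- The action of the symmetric group on `k[x_1, …, x_n]` by permuting the variables, as a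
`k`-linear representation. -/
noncomputable def permRep (k : Type*) [CommRing k] (n : ℕ) :
    Representation k (Equiv.Perm (Fin n)) (MvPolynomial (Fin n) k) where
  toFun g := (rename (R := k) (g : Fin n → Fin n)).toLinearMap
  map_one' := by
    apply LinearMap.ext
    intro f
    simp
  map_mul' g h := by
    apply LinearMap.ext
    intro f
    simp [rename_rename, Equiv.Perm.coe_mul]

/-- The ring of invariants `k[x_1, …, x_n]^{S_n}`, i.e. the symmetric polynomials. It is the
polynomial ring `k[e_1, …, e_n]`, see `symmRing_eq_adjoin` and `algebraicIndependent_esymm`. -/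
noncomputable abbrev SymmRing (k : Type*) [CommRing k] (n : ℕ) :
    Subalgebra k (MvPolynomial (Fin n) k) :=
  symmetricSubalgebra (Fin n) k

noncomputable instance (k : Type*) [CommRing k] (n : ℕ) (I : Ideal (SymmRing k n)) :
    Module (SymmRing k n) I :=
  Submodule.module I

/-- The ring of invariants is generated by `e_1, …, e_n`. -/
theorem symmRing_eq_adjoin (k : Type*) [CommRing k] (n : ℕ) :
    SymmRing k n = Algebra.adjoin k (Set.range fun j : Fin n => esymm (Fin n) k (j + 1)) := by
  apply le_antisymm
  · intro f hf
    obtain ⟨q, hq⟩ := esymmAlgHom_surjective (R := k) (σ := Fin n) (n := n) (by simp) ⟨f, hf⟩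
    have h : f = aeval (fun j : Fin n => esymm (Fin n) k (j + 1)) q := by
      rw [← esymmAlgHom_apply, hq]
    rw [h, Algebra.adjoin_range_eq_range_aeval]
    exact ⟨q, rfl⟩
  · rw [Algebra.adjoin_le_iff]
    rintro _ ⟨j, rfl⟩
    exact esymm_isSymmetric _ _ _

/-- The elementary symmetric polynomials `e_1, …, e_n` are algebraically independent. -/
theorem algebraicIndependent_esymm (k : Type*) [CommRing k] (n : ℕ) :
    AlgebraicIndependent k (fun j : Fin n => esymm (Fin n) k (j + 1)) := by
  intro a b hab
  apply esymmAlgHom_injective (R := k) (σ := Fin n) (n := n) (by simp)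
  apply Subtype.ext
  simpa only [esymmAlgHom_apply] using hab

/-- The `k`-span of all `g(u) - u`, with `u` in `k[x_1, …, x_n]` and `g` in `S_n`, regarded as a
submodule over the ring of invariants. -/
noncomputable def cofixedKer (k : Type*) [CommRing k] (n : ℕ) :
    Submodule (SymmRing k n) (MvPolynomial (Fin n) k) where
  carrier := (Representation.Coinvariants.ker (permRep k n) : Set (MvPolynomial (Fin n) k))
  add_mem' := fun ha hb => add_mem ha hb
  zero_mem' := zero_mem _
  smul_mem' := by
    intro r f hf
    refine Submodule.span_induction (p := fun x _ =>
      r • x ∈ Representation.Coinvariants.ker (permRep k n)) ?_ ?_ ?_ ?_ hf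
    · rintro _ ⟨⟨g, u⟩, rfl⟩
      apply Submodule.subset_span
      refine ⟨(g, r • u), ?_⟩
      have hr : rename (g : Fin n → Fin n) (r : MvPolynomial (Fin n) k) = r := r.2 g
      simp [permRep, Subalgebra.smul_def, mul_sub, hr]
    · simp
    · intro x y _ _ hx hy
      rw [smul_add]
      exact add_mem hx hy
    · intro a x _ hx
      rw [smul_comm]
      exact Submodule.smul_mem _ a hx

/-- The cofixed space `k[x_1, …, x_n]_{S_n}`, as a module over the ring of invariants. Its
underlying `k`-module is `(permRep k n).Coinvariants`. -/
def CofixedSpace (k : Type*) [CommRing k] (n : ℕ) : Type _ :=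
  MvPolynomial (Fin n) k ⧸ cofixedKer k n

noncomputable instance (k : Type*) [CommRing k] (n : ℕ) : AddCommGroup (CofixedSpace k n) :=
  Submodule.Quotient.addCommGroup (cofixedKer k n)

noncomputable instance (k : Type*) [CommRing k] (n : ℕ) :
    Module (SymmRing k n) (CofixedSpace k n) :=
  Submodule.Quotient.module (cofixedKer k n)

/-- The transfer map `f ↦ ∑ g(f)`, the sum over all `g` in `S_n`, from `k[x_1, …, x_n]` to the
ring of invariants; it is linear over the ring of invariants. -/
noncomputable def transfer (k : Type*) [CommRing k] (n : ℕ) :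
    MvPolynomial (Fin n) k →ₗ[SymmRing k n] SymmRing k n where
  toFun f := ⟨∑ g : Equiv.Perm (Fin n), permRep k n g f, by
    intro h
    rw [map_sum]
    refine Fintype.sum_equiv (Equiv.mulLeft h) _ _ fun g => ?_
    simp [permRep, rename_rename, Equiv.Perm.coe_mul]⟩
  map_add' a b := by
    apply Subtype.ext
    simp [Finset.sum_add_distrib]
  map_smul' r f := by
    apply Subtype.ext
    have hr (g : Equiv.Perm (Fin n)) :
        rename (g : Fin n → Fin n) (r : MvPolynomial (Fin n) k) = r := r.2 g
    simp [permRep, Subalgebra.smul_def, hr, Finset.mul_sum]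

/-- The elementary symmetric polynomial `e_j` in `x_1, …, x_n`, in the ring of invariants. -/
noncomputable def elemSymm (k : Type*) [CommRing k] (n j : ℕ) : SymmRing k n :=
  ⟨esymm (Fin n) k j, esymm_isSymmetric _ _ _⟩

/-- For `0 ≤ j ≤ p - 1`, the `j`-th entry of the list
`p, e_1 e_p - e_{p+1}, …, e_i e_p - e_{p+i}, e_{i+1}, …, e_{p-1}`, where `i = n - p`. -/
noncomputable def idealGen (k : Type*) [CommRing k] (p n j : ℕ) : SymmRing k n :=
  if j = 0 then (p : SymmRing k n)
  else if j ≤ n - p then elemSymm k n j * elemSymm k n p - elemSymm k n (p + j)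
  else elemSymm k n j

/-- The list `p, e_1 e_p - e_{p+1}, …, e_i e_p - e_{p+i}, e_{i+1}, …, e_{p-1}`. -/
noncomputable def genList (k : Type*) [CommRing k] (p n : ℕ) : List (SymmRing k n) :=
  (List.range p).map (idealGen k p n)

end

/-!
Over `k = ℤ_(p)`, both the ideal `I` generated by the list and the image of the transfer are the
kernel of one ring homomorphism on the ring of invariants. Write `n = p + i` with `i < p`. Let
`collapseHom` reduce modulo `p` and set `x_1 = ⋯ = x_p = w`, keeping the other variables
`y_1, …, y_i` apart.

*The transfer.* Modulo `g(u) - u` every polynomial is a combination of chosen orbit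
representatives of monomials, and the transfer multiplies the coefficient of a representative by
the order of its stabilizer (`coeff_transfer_of_orbitRep`). In characteristic zero it is therefore
injective on the cofixed space (`ker_transfer`), which is thus isomorphic to its image. That image
contains the symmetric polynomials whose coefficients are divisible by the orders of the
stabilizers (`mem_range_transfer`). As `p ^ 2` does not divide `n!`, this only concerns monomials
having `p` equal exponents, whose coefficients have to be divisible by `p`. After a permutation
such a monomial is invariant under the rotation of the first `p` variables. The rotation permutes
freely the other monomials with the same image, so the coefficient modulo `p` of the invariant one
can be read off from the image under `collapseHom` (`coeff_collapseHom_of_invariant`). Hence an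
invariant polynomial killed by `collapseHom` is a transfer. The converse holds because the terms of
a transfer are constant on cosets of a group of order `p` (`collapseHom_transfer`).

*The ideal.* From `(T + w) ^ p = T ^ p + w ^ p` one gets
`e_j ↦ e_j(y) + w ^ p e_{j-p}(y)` (`collapseHom_esymm`), so `I` is killed. Modulo `I` every
invariant is a polynomial in `e_1, …, e_i, e_p`, whose images `e_1(y), …, e_i(y), w ^ p` are
algebraically independent over `k / p`, so an invariant that is killed lies in `I`
(`mem_of_collapseHom_eq_zero`).

*Regularity.* The substitution `e_{p+j} ↦ e_j e_p - e_{p+j}` is an involution of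
`k[e_1, …, e_n]` which turns the generators into `p` followed by distinct variables
(`genEquiv_gen`), and these form a regular sequence (`isRegular_C_X`).
-/

open MvPolynomial

/-! ### Orbits of monomials and the image of the transfer -/

/-- Two exponent vectors are equivalent when a permutation of the variables carries one to the
other. -/
def expSetoid (n : ℕ) : Setoid (Fin n →₀ ℕ) where
  r a b := ∃ g : Equiv.Perm (Fin n), a.mapDomain g = b
  iseqv :=
    { refl := fun a => ⟨1, by simp⟩
      symm := by
        rintro a _ ⟨g, rfl⟩
        refine ⟨g⁻¹, ?_⟩
        rw [← Finsupp.mapDomain_comp, ← Equiv.Perm.coe_mul]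
        simp
      trans := by
        rintro a _ _ ⟨g, rfl⟩ ⟨h, rfl⟩
        exact ⟨h * g, by rw [← Finsupp.mapDomain_comp, Equiv.Perm.coe_mul]⟩ }

/-- A chosen representative of the orbit of an exponent vector. -/
noncomputable def orbitRep {n : ℕ} (m : Fin n →₀ ℕ) : Fin n →₀ ℕ :=
  (Quotient.mk (expSetoid n) m).out

theorem orbitRep_mapDomain {n : ℕ} (m : Fin n →₀ ℕ) (g : Equiv.Perm (Fin n)) :
    orbitRep (m.mapDomain g) = orbitRep m := by
  have h : Quotient.mk (expSetoid n) (m.mapDomain g) = Quotient.mk (expSetoid n) m :=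
    Quotient.sound ((expSetoid n).symm ⟨g, rfl⟩)
  rw [orbitRep, h, orbitRep]

theorem exists_mapDomain_eq_orbitRep {n : ℕ} (m : Fin n →₀ ℕ) :
    ∃ g : Equiv.Perm (Fin n), m.mapDomain g = orbitRep m :=
  (expSetoid n).symm (Quotient.mk_out (s := expSetoid n) m)

theorem orbitRep_orbitRep {n : ℕ} (m : Fin n →₀ ℕ) : orbitRep (orbitRep m) = orbitRep m := by
  obtain ⟨g, hg⟩ := exists_mapDomain_eq_orbitRep m
  rw [← hg, orbitRep_mapDomain, hg]

/-- The order of the stabilizer of an exponent vector in the symmetric group. -/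
noncomputable def stabCard {n : ℕ} (m : Fin n →₀ ℕ) : ℕ :=
  (Finset.univ.filter fun g : Equiv.Perm (Fin n) => m.mapDomain g = m).card

section

variable {k : Type*} [CommRing k] {n : ℕ}

theorem coeff_mapDomain_of_isSymmetric {f : MvPolynomial (Fin n) k} (hf : f.IsSymmetric)
    (g : Equiv.Perm (Fin n)) (m : Fin n →₀ ℕ) : coeff (m.mapDomain g) f = coeff m f := by
  conv_lhs => rw [← hf g]
  exact coeff_rename_mapDomain _ g.injective _ _

theorem permRep_apply (g : Equiv.Perm (Fin n)) (f : MvPolynomial (Fin n) k) :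
    permRep k n g f = rename g f := rfl

theorem coe_transfer (f : MvPolynomial (Fin n) k) :
    (transfer k n f : MvPolynomial (Fin n) k) = ∑ g : Equiv.Perm (Fin n), rename g f := rfl

theorem sub_rename_mem_cofixedKer (u : MvPolynomial (Fin n) k) (g : Equiv.Perm (Fin n)) :
    u - rename g u ∈ cofixedKer k n := by
  rw [← neg_sub]
  exact neg_mem (Submodule.subset_span ⟨(g, u), rfl⟩ :
    permRep k n g u - u ∈ Representation.Coinvariants.ker (permRep k n))

/-- Modulo `cofixedKer`, every polynomial is a combination of the chosen orbit representatives. -/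
theorem exists_sub_mem_cofixedKer (u : MvPolynomial (Fin n) k) :
    ∃ v : MvPolynomial (Fin n) k, u - v ∈ cofixedKer k n ∧
      ∀ m, orbitRep m ≠ m → coeff m v = 0 := by
  induction u using MvPolynomial.induction_on' with
  | monomial m a =>
    obtain ⟨g, hg⟩ := exists_mapDomain_eq_orbitRep m
    refine ⟨monomial (orbitRep m) a, ?_, fun m' hm' => ?_⟩
    · have := sub_rename_mem_cofixedKer (monomial m a) g
      rwa [rename_monomial, hg] at this
    · rw [coeff_monomial, if_neg]
      rintro rfl
      exact hm' (orbitRep_orbitRep m)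
  | add u₁ u₂ h₁ h₂ =>
    obtain ⟨v₁, h₁, h₁'⟩ := h₁
    obtain ⟨v₂, h₂, h₂'⟩ := h₂
    refine ⟨v₁ + v₂, ?_, fun m hm => by rw [coeff_add, h₁' m hm, h₂' m hm, add_zero]⟩
    rw [add_sub_add_comm]
    exact add_mem h₁ h₂

/-- The transfer multiplies the coefficient of an orbit representative by the order of its
stabilizer. -/
theorem coeff_transfer_of_orbitRep {v : MvPolynomial (Fin n) k}
    (hv : ∀ m, orbitRep m ≠ m → coeff m v = 0) {m : Fin n →₀ ℕ} (hm : orbitRep m = m) :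
    coeff m (transfer k n v : MvPolynomial (Fin n) k) = stabCard m * coeff m v := by
  have key (g : Equiv.Perm (Fin n)) :
      coeff m (rename g v) = if m.mapDomain g = m then coeff m v else 0 := by
    obtain ⟨d, rfl⟩ : ∃ d : Fin n →₀ ℕ, d.mapDomain g = m :=
      ⟨m.mapDomain (g⁻¹ : Equiv.Perm (Fin n)), by
        rw [← Finsupp.mapDomain_comp, ← Equiv.Perm.coe_mul]; simp⟩
    rw [coeff_rename_mapDomain _ g.injective]
    by_cases hd : orbitRep d = d
    · rw [orbitRep_mapDomain, hd] at hm
      simp [← hm]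
    · rw [hv d hd]
      split_ifs with h
      · have h' : d.mapDomain g = d := Finsupp.mapDomain_injective g.injective h
        rw [h', hv d hd]
      · rfl
  rw [coe_transfer, coeff_sum, Finset.sum_congr rfl fun g _ => key g, Finset.sum_ite,
    Finset.sum_const, Finset.sum_const_zero, add_zero, nsmul_eq_mul, stabCard]

theorem transfer_eq_zero_of_mem_cofixedKer {u : MvPolynomial (Fin n) k}
    (hu : u ∈ cofixedKer k n) : transfer k n u = 0 := by
  refine Submodule.span_induction (p := fun x _ => transfer k n x = 0) ?_ ?_ ?_ ?_ hu
  · rintro _ ⟨⟨g, u⟩, rfl⟩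
    rw [map_sub, sub_eq_zero]
    apply Subtype.ext
    simp only [coe_transfer, permRep_apply, rename_rename, ← Equiv.Perm.coe_mul]
    exact Fintype.sum_equiv (Equiv.mulRight g) _ _ fun h => rfl
  · simp
  · intro x y _ _ hx hy
    rw [map_add, hx, hy, add_zero]
  · intro a x _ hx
    have : a • x = algebraMap k (SymmRing k n) a • x := by
      rw [Subalgebra.smul_def, Algebra.smul_def]; rfl
    rw [this, map_smul, hx, smul_zero]

theorem stabCard_pos (m : Fin n →₀ ℕ) : 0 < stabCard m :=
  Finset.card_pos.2 ⟨1, by simp⟩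

/-- In characteristic zero the transfer is injective on the cofixed space: it sends the basis of
orbits to nonzero multiples of the orbit sums. -/
theorem ker_transfer [IsDomain k] [CharZero k] :
    LinearMap.ker (transfer k n) = cofixedKer k n := by
  apply le_antisymm
  · intro u hu
    obtain ⟨v, huv, hv⟩ := exists_sub_mem_cofixedKer u
    have h0 : transfer k n v = 0 := by
      have := transfer_eq_zero_of_mem_cofixedKer huv
      rw [map_sub, LinearMap.mem_ker.1 hu, zero_sub, neg_eq_zero] at this
      exact this
    have hv0 : v = 0 := by
      ext m
      by_cases hm : orbitRep m = m
      · have := coeff_transfer_of_orbitRep hv hm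
        rw [h0] at this
        simpa [(stabCard_pos m).ne'] using this.symm
      · exact hv m hm
    simpa [hv0] using huv
  · exact fun u hu => transfer_eq_zero_of_mem_cofixedKer hu

/-- A symmetric polynomial is a transfer as soon as each coefficient is divisible by the order of
the stabilizer of its monomial. -/
theorem mem_range_transfer {f : SymmRing k n}
    (hf : ∀ m, (stabCard m : k) ∣ coeff m (f : MvPolynomial (Fin n) k)) :
    f ∈ LinearMap.range (transfer k n) := by
  classical
  choose c hc using hf
  let v : MvPolynomial (Fin n) k :=
    ∑ m ∈ (f : MvPolynomial (Fin n) k).support with orbitRep m = m, monomial m (c m)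
  have hcoeff (m : Fin n →₀ ℕ) : coeff m v =
      if m ∈ (f : MvPolynomial (Fin n) k).support ∧ orbitRep m = m then c m else 0 := by
    simp only [v, coeff_sum, coeff_monomial, Finset.sum_ite_eq', Finset.mem_filter]
  have hv (m : Fin n →₀ ℕ) (hm : orbitRep m ≠ m) : coeff m v = 0 := by
    rw [hcoeff, if_neg fun h => hm h.2]
  refine ⟨v, Subtype.ext (MvPolynomial.ext _ _ fun m => ?_)⟩
  -- Both sides are symmetric, so it suffices to compare coefficients of representatives.
  obtain ⟨g, hg⟩ := exists_mapDomain_eq_orbitRep m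
  rw [← coeff_mapDomain_of_isSymmetric (transfer k n v).2 g,
    ← coeff_mapDomain_of_isSymmetric f.2 g, hg,
    coeff_transfer_of_orbitRep hv (orbitRep_orbitRep m), hcoeff]
  split_ifs with h
  · exact (hc _).symm
  · rw [mul_zero]
    by_contra h'
    exact h ⟨mem_support_iff.2 (Ne.symm h'), orbitRep_orbitRep m⟩

end

/-! ### Stabilizers of monomials -/

theorem stabCard_eq_prod {n : ℕ} (m : Fin n →₀ ℕ) :
    stabCard m =
      ∏ v ∈ Finset.univ.image m, (Finset.univ.filter fun a => m a = v).card.factorial := by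
  classical
  have key (g : Equiv.Perm (Fin n)) : m.mapDomain g = m ↔ (⇑m) ∘ g = m := by
    rw [DFunLike.ext_iff, funext_iff, g.surjective.forall]
    simp only [Finsupp.mapDomain_apply g.injective, Function.comp_apply, eq_comm]
  -- `DomMulAct.stabilizer_card` needs a finite codomain.
  let f : Fin n → {v // v ∈ Finset.univ.image m} := fun a => ⟨m a, by simp⟩
  have h := DomMulAct.stabilizer_card f
  rw [Fintype.card_subtype] at h
  rw [stabCard, ← Finset.prod_coe_sort]
  convert h using 1
  · congr 1
    ext g
    simp only [Finset.mem_filter, Finset.mem_univ, true_and, key, funext_iff, f,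
      Function.comp_apply, Subtype.mk.injEq]
  · refine Finset.prod_congr rfl fun v _ => ?_
    rw [Fintype.card_subtype]
    simp only [f, Subtype.ext_iff]

theorem stabCard_dvd_factorial {n : ℕ} (m : Fin n →₀ ℕ) : stabCard m ∣ n.factorial := by
  rw [stabCard_eq_prod]
  refine (Nat.prod_factorial_dvd_factorial_sum _ _).trans (dvd_of_eq ?_)
  rw [← Finset.card_eq_sum_card_image, Finset.card_univ, Fintype.card_fin]

theorem exists_le_card_of_dvd_stabCard {n p : ℕ} (hp : p.Prime) {m : Fin n →₀ ℕ}
    (h : p ∣ stabCard m) : ∃ v, p ≤ (Finset.univ.filter fun a => m a = v).card := by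
  rw [stabCard_eq_prod, hp.prime.dvd_finsetProd_iff] at h
  obtain ⟨v, -, hv⟩ := h
  exact ⟨v, hp.dvd_factorial.1 hv⟩

theorem not_sq_dvd_factorial {n p : ℕ} (hp : p.Prime) (hn : n < 2 * p) :
    ¬ p ^ 2 ∣ n.factorial := by
  have h2 := hp.two_le
  rw [hp.pow_dvd_factorial_iff (b := 2)]
  · simpa using Nat.div_lt_of_lt_mul (by linarith : n < p * 2)
  · exact Nat.log_lt_of_lt_pow' (by norm_num) (by nlinarith)

/-- For `n < 2p` the order of a stabilizer is, up to a unit, either `1` or `p`. -/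
theorem stabCard_dvd_of {k : Type*} [CommRing k] {n p : ℕ} (hp : p.Prime) (hn : n < 2 * p)
    (hu : ∀ N : ℕ, ¬ p ∣ N → IsUnit (N : k)) {m : Fin n →₀ ℕ} {c : k}
    (hc : p ∣ stabCard m → (p : k) ∣ c) : (stabCard m : k) ∣ c := by
  by_cases h : p ∣ stabCard m
  · obtain ⟨N, hN⟩ := h
    have hpN : ¬ p ∣ N := fun hd => not_sq_dvd_factorial hp hn <| by
      refine dvd_trans ?_ (stabCard_dvd_factorial m)
      rw [hN, sq]
      exact mul_dvd_mul_left p hd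
    rw [hN, Nat.cast_mul, (hu N hpN).mul_right_dvd]
    exact hc ⟨N, hN⟩
  · exact (hu _ h).dvd

/-! ### Identifying the first `p` variables modulo `p` -/

/-- The map on variable indices which identifies the first `p` variables and keeps the other `i`
variables apart. -/
def collapse (p i : ℕ) : Fin (p + i) → Option (Fin i) :=
  Fin.addCases (fun _ => none) some

/-- Reduction modulo `p` followed by setting `x_1 = ⋯ = x_p = w`. The variable `w` is `X none`,
and `x_{p+l}` is sent to `X (some l)`. -/
noncomputable def collapseHom (k : Type*) [CommRing k] (p i : ℕ) :
    MvPolynomial (Fin (p + i)) k →+*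
      MvPolynomial (Option (Fin i)) (k ⧸ Ideal.span {(p : k)}) :=
  (rename (collapse p i)).toRingHom.comp (MvPolynomial.map (Ideal.Quotient.mk _))

/-- The cyclic permutation of the first `p` of `p + i` indices. -/
def rotFirst (p i : ℕ) [NeZero p] : Equiv.Perm (Fin (p + i)) :=
  finSumFinEquiv.permCongr (Equiv.sumCongr (Equiv.addRight (1 : Fin p)) (1 : Equiv.Perm (Fin i)))

section

variable {p i : ℕ}

@[simp] theorem collapse_castAdd (a : Fin p) : collapse p i (Fin.castAdd i a) = none := by
  simp [collapse]

@[simp] theorem collapse_natAdd (l : Fin i) : collapse p i (Fin.natAdd p l) = some l := by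
  simp [collapse]

theorem mapDomain_collapse_apply (m : Fin (p + i) →₀ ℕ) (t : Option (Fin i)) :
    m.mapDomain (collapse p i) t = ∑ x, if collapse p i x = t then m x else 0 := by
  classical
  rw [Finsupp.mapDomain, Finsupp.sum_fintype _ _ (by simp), Finsupp.finsetSum_apply]
  simp [Finsupp.single_apply]

variable [NeZero p]

@[simp] theorem rotFirst_castAdd (a : Fin p) :
    rotFirst p i (Fin.castAdd i a) = Fin.castAdd i (a + 1) := by
  simp [rotFirst, Equiv.permCongr_apply]

@[simp] theorem rotFirst_natAdd (l : Fin i) :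
    rotFirst p i (Fin.natAdd p l) = Fin.natAdd p l := by
  simp [rotFirst, Equiv.permCongr_apply]

theorem collapse_rotFirst (a : Fin (p + i)) : collapse p i (rotFirst p i a) = collapse p i a := by
  induction a using Fin.addCases <;> simp

open Fin.CommRing in
theorem rotFirst_pow_castAdd (a : Fin p) (j : ℕ) :
    (rotFirst p i ^ j) (Fin.castAdd i a) = Fin.castAdd i (a + (j : Fin p)) := by
  induction j with
  | zero => simp
  | succ j ih =>
    rw [pow_succ', Equiv.Perm.mul_apply, ih, rotFirst_castAdd, Nat.cast_succ, add_assoc]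

open Fin.CommRing in
theorem rotFirst_pow_self : rotFirst p i ^ p = 1 := by
  ext a
  induction a using Fin.addCases with
  | left a => simp [rotFirst_pow_castAdd]
  | right l =>
    have (j : ℕ) : (rotFirst p i ^ j) (Fin.natAdd p l) = Fin.natAdd p l := by
      induction j with
      | zero => simp
      | succ j ih => rw [pow_succ', Equiv.Perm.mul_apply, ih, rotFirst_natAdd]
    simp [this]

theorem iterate_mapDomain_rotFirst (m : Fin (p + i) →₀ ℕ) :
    (Finsupp.mapDomain (rotFirst p i))^[p] m = m := by
  have (j : ℕ) : (Finsupp.mapDomain (rotFirst p i))^[j] m =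
      Finsupp.mapDomain (rotFirst p i ^ j : Equiv.Perm _) m := by
    induction j with
    | zero => simp
    | succ j ih =>
      rw [Function.iterate_succ_apply', ih, ← Finsupp.mapDomain_comp, ← Equiv.Perm.coe_mul,
        ← pow_succ']
  rw [this, rotFirst_pow_self]
  simp

open Fin.CommRing in
theorem mapDomain_rotFirst_eq_iff {m : Fin (p + i) →₀ ℕ} :
    m.mapDomain (rotFirst p i) = m ↔ ∀ a : Fin p, m (Fin.castAdd i a) = m (Fin.castAdd i 0) := by
  have h0 : m.mapDomain (rotFirst p i) = m ↔ ∀ x, m (rotFirst p i x) = m x := by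
    rw [DFunLike.ext_iff, (rotFirst p i).surjective.forall]
    simp only [Finsupp.mapDomain_apply (rotFirst p i).injective, eq_comm]
  rw [h0]
  constructor
  · intro h a
    have (j : ℕ) : m (Fin.castAdd i ((j : ℕ) : Fin p)) = m (Fin.castAdd i 0) := by
      induction j with
      | zero => simp
      | succ j ih => rw [Nat.cast_succ, ← rotFirst_castAdd, h, ih]
    simpa using this a
  · intro h x
    induction x using Fin.addCases with
    | left a => rw [rotFirst_castAdd, h, h a]
    | right l => rw [rotFirst_natAdd]

/-- A monomial invariant under the rotation is determined by its image under `collapse`. -/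
theorem eq_of_mapDomain_collapse_eq {m d : Fin (p + i) →₀ ℕ}
    (hm : m.mapDomain (rotFirst p i) = m) (hd : d.mapDomain (rotFirst p i) = d)
    (h : m.mapDomain (collapse p i) = d.mapDomain (collapse p i)) : m = d := by
  rw [mapDomain_rotFirst_eq_iff] at hm hd
  have hnone := DFunLike.congr_fun h none
  simp only [mapDomain_collapse_apply, Fin.sum_univ_add, collapse_castAdd, collapse_natAdd,
    if_true, reduceCtorEq, if_false, Finset.sum_const_zero, add_zero, hm, hd] at hnone
  simp only [Finset.sum_const, Finset.card_univ, Fintype.card_fin, smul_eq_mul,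
    mul_eq_mul_left_iff, NeZero.ne p, or_false] at hnone
  ext x
  induction x using Fin.addCases with
  | left a => rw [hm, hd, hnone]
  | right l =>
    have := DFunLike.congr_fun h (some l)
    simpa [mapDomain_collapse_apply, Fin.sum_univ_add] using this

end

/-- If a map of order dividing `p` has a single fixed point on a finite set, then a sum over that
set of an invariant function in characteristic `p` is the value at the fixed point. -/
theorem sum_eq_of_unique_fixedPoint {p : ℕ} [Fact p.Prime] {X R : Type*} [CommRing R] [CharP R p]
    (s : Finset X) (σ : X → X) (hσ : ∀ x, σ^[p] x = x) (hs : ∀ x ∈ s, σ x ∈ s) (F : X → R)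
    (hF : ∀ x ∈ s, F (σ x) = F x) (x₀ : X) (h₀ : ∀ x ∈ s, σ x = x ↔ x = x₀) (hx₀ : x₀ ∈ s) :
    ∑ x ∈ s, F x = F x₀ := by
  classical
  -- Count modulo `p` on each level set of `F`.
  have key (b : R) : ((s.filter fun x => F x = b).card : R) = if b = F x₀ then 1 else 0 := by
    set t := s.filter fun x => F x = b with ht
    have hmem (x) (hx : x ∈ t) : σ x ∈ t := by
      rw [ht, Finset.mem_filter] at hx ⊢
      exact ⟨hs x hx.1, (hF x hx.1).trans hx.2⟩
    let f : Function.End t := fun x => ⟨σ x, hmem x x.2⟩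
    have hf : f ^ p ^ 1 = 1 := by
      rw [pow_one]
      have (j : ℕ) (x : t) : (((f ^ j) x : t) : X) = σ^[j] x := by
        induction j with
        | zero => rfl
        | succ j ih =>
          rw [Function.iterate_succ_apply', ← ih, pow_succ']
          rfl
      funext x
      exact Subtype.ext ((this p x).trans (hσ x))
    have hcard := Equiv.Perm.card_fixedPoints_modEq hf
    rw [Fintype.card_coe] at hcard
    rw [(CharP.natCast_eq_natCast R p).2 hcard]
    split_ifs with hb
    · have : Fintype.card (Function.fixedPoints f) = 1 := by
        rw [Fintype.card_eq_one_iff]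
        have hx₀t : x₀ ∈ t := by rw [ht, Finset.mem_filter]; exact ⟨hx₀, hb.symm⟩
        refine ⟨⟨⟨x₀, hx₀t⟩, Subtype.ext ((h₀ x₀ hx₀).2 rfl)⟩, ?_⟩
        rintro ⟨⟨x, hx⟩, hfx⟩
        have := (h₀ x (Finset.mem_filter.1 hx).1).1 (congrArg Subtype.val hfx)
        subst this
        rfl
      rw [this, Nat.cast_one]
    · have : Fintype.card (Function.fixedPoints f) = 0 := by
        rw [Fintype.card_eq_zero_iff]
        refine ⟨fun ⟨⟨x, hx⟩, hfx⟩ => hb ?_⟩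
        have := (h₀ x (Finset.mem_filter.1 hx).1).1 (congrArg Subtype.val hfx)
        rw [← this, (Finset.mem_filter.1 hx).2]
      rw [this, Nat.cast_zero]
  calc ∑ x ∈ s, F x = ∑ b ∈ s.image F, (s.filter fun x => F x = b).card • b :=
        Finset.sum_comp (fun b => b) F
    _ = ∑ b ∈ s.image F, if b = F x₀ then b else 0 := by
        refine Finset.sum_congr rfl fun b _ => ?_
        rw [nsmul_eq_mul, key]
        split_ifs <;> simp
    _ = F x₀ := by
        rw [Finset.sum_ite_eq' , if_pos (Finset.mem_image_of_mem F hx₀)]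

section

variable {k : Type*} [CommRing k] {p i : ℕ}

theorem coeff_collapseHom [DecidableEq (Option (Fin i) →₀ ℕ)] {f : MvPolynomial (Fin (p + i)) k}
    {s : Finset (Fin (p + i) →₀ ℕ)} (hs : f.support ⊆ s) (t : Option (Fin i) →₀ ℕ) :
    coeff t (collapseHom k p i f) = ∑ m ∈ s with m.mapDomain (collapse p i) = t,
      Ideal.Quotient.mk (Ideal.span {(p : k)}) (coeff m f) := by
  have hf : f = ∑ m ∈ s, monomial m (coeff m f) := by
    conv_lhs => rw [f.as_sum]
    refine Finset.sum_subset hs fun m _ hm => ?_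
    rw [notMem_support_iff.1 hm, monomial_zero]
  conv_lhs => rw [hf]
  simp only [collapseHom, map_sum, RingHom.comp_apply, map_monomial, AlgHom.toRingHom_eq_coe,
    RingHom.coe_coe, rename_monomial, coeff_sum, coeff_monomial]
  rw [Finset.sum_filter]
  exact Finset.sum_congr rfl fun m _ => by congr

theorem collapseHom_rename_rotFirst [NeZero p] (f : MvPolynomial (Fin (p + i)) k) :
    collapseHom k p i (rename (rotFirst p i) f) = collapseHom k p i f := by
  simp only [collapseHom, RingHom.comp_apply, AlgHom.toRingHom_eq_coe, RingHom.coe_coe,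
    map_rename, rename_rename]
  rw [show collapse p i ∘ rotFirst p i = collapse p i from funext collapse_rotFirst]

variable [Fact p.Prime]

theorem charP_quotient (hp : ¬ IsUnit (p : k)) : CharP (k ⧸ Ideal.span {(p : k)}) p :=
  CharP.quotient k p hp

/-- The rotation permutes freely the non-invariant monomials with a given image under
`collapseHom`, so modulo `p` only the coefficient of the invariant one survives. -/
theorem coeff_collapseHom_of_invariant (hp : ¬ IsUnit (p : k))
    {f : MvPolynomial (Fin (p + i)) k} (hf : f.IsSymmetric) {m : Fin (p + i) →₀ ℕ}
    (hm : m.mapDomain (rotFirst p i) = m) :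
    coeff (m.mapDomain (collapse p i)) (collapseHom k p i f) =
      Ideal.Quotient.mk (Ideal.span {(p : k)}) (coeff m f) := by
  classical
  have := charP_quotient hp
  -- The invariant monomial need not occur in `f`; adjoining it to the support changes nothing.
  rw [coeff_collapseHom (Finset.subset_insert m f.support)]
  have hcoll (d : Fin (p + i) →₀ ℕ) : (d.mapDomain (rotFirst p i)).mapDomain (collapse p i) =
      d.mapDomain (collapse p i) := by
    rw [← Finsupp.mapDomain_comp, show collapse p i ∘ rotFirst p i = collapse p i from
      funext collapse_rotFirst]
  have hrot (d : Fin (p + i) →₀ ℕ) : coeff (d.mapDomain (rotFirst p i)) f = coeff d f :=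
    coeff_mapDomain_of_isSymmetric hf _ _
  refine sum_eq_of_unique_fixedPoint _ (Finsupp.mapDomain (rotFirst p i))
    iterate_mapDomain_rotFirst (fun d hd => ?_) _ (fun d _ => by rw [hrot]) m (fun d hd => ?_)
    (by simp)
  · simp only [Finset.mem_filter, Finset.mem_insert, mem_support_iff, hcoll, hrot] at hd ⊢
    refine ⟨hd.1.imp_left ?_, hd.2⟩
    rintro rfl
    exact hm
  · refine ⟨fun h => eq_of_mapDomain_collapse_eq h hm (Finset.mem_filter.1 hd).2, ?_⟩
    rintro rfl
    exact hm

/-- Exponent vectors with `p` equal entries can be permuted so that the first `p` entries are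
equal. -/
theorem exists_mapDomain_invariant {m : Fin (p + i) →₀ ℕ} (h : p ∣ stabCard m) :
    ∃ g : Equiv.Perm (Fin (p + i)),
      (m.mapDomain g).mapDomain (rotFirst p i) = m.mapDomain g := by
  obtain ⟨v, hv⟩ := exists_le_card_of_dvd_stabCard (Fact.out : p.Prime) h
  -- Send `p` of the positions with the common entry `v` to the first `p` positions.
  obtain ⟨T, hT, hcard⟩ := Finset.exists_subset_card_eq hv
  let F : Finset (Fin (p + i)) := Finset.univ.map (Fin.castAddEmb i)
  have hF : T.card = F.card := by simp [F, hcard]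
  let g : Equiv.Perm (Fin (p + i)) := (Finset.equivOfCardEq hF).extendSubtype
  refine ⟨g, ?_⟩
  have key (a : Fin p) : m.mapDomain g (Fin.castAdd i a) = v := by
    obtain ⟨x, hx⟩ := (Finset.equivOfCardEq hF).surjective ⟨Fin.castAdd i a, by simp [F]⟩
    have hgx : g x = Fin.castAdd i a := by
      rw [show g x = Finset.equivOfCardEq hF ⟨x, x.2⟩ from Equiv.extendSubtype_apply_of_mem _ _ x.2]
      exact congrArg Subtype.val hx
    rw [← hgx, Finsupp.mapDomain_apply g.injective]
    exact (Finset.mem_filter.1 (hT x.2)).2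
  rw [mapDomain_rotFirst_eq_iff]
  intro a
  rw [key, key]

/-- A symmetric polynomial which vanishes under `collapseHom` is a transfer. -/
theorem mem_range_transfer_of_collapseHom_eq_zero (hip : i < p) (hp : ¬ IsUnit (p : k))
    (hu : ∀ N : ℕ, ¬ p ∣ N → IsUnit (N : k)) {f : SymmRing k (p + i)}
    (hf : collapseHom k p i (f : MvPolynomial (Fin (p + i)) k) = 0) :
    f ∈ LinearMap.range (transfer k (p + i)) := by
  refine mem_range_transfer fun m => stabCard_dvd_of Fact.out (by omega) hu fun h => ?_
  obtain ⟨g, hg⟩ := exists_mapDomain_invariant h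
  have := coeff_collapseHom_of_invariant hp f.2 hg
  rw [hf, coeff_zero, coeff_mapDomain_of_isSymmetric f.2] at this
  rw [← Ideal.mem_span_singleton, ← Ideal.Quotient.eq_zero_iff_mem]
  exact this.symm

/-- Transfers vanish under `collapseHom`: the summands are constant on the cosets of the group
of order `p` generated by the rotation. -/
theorem collapseHom_transfer (hp : ¬ IsUnit (p : k)) (u : MvPolynomial (Fin (p + i)) k) :
    collapseHom k p i (transfer k (p + i) u : MvPolynomial (Fin (p + i)) k) = 0 := by
  classical
  have := charP_quotient hp
  let c := rotFirst p i
  let H := Subgroup.zpowers c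
  have hc1 : c ≠ 1 := fun h => by
    have h2 := rotFirst_castAdd (i := i) (0 : Fin p)
    have hp1 : 1 < p := (Fact.out : p.Prime).one_lt
    rw [show rotFirst p i = 1 from h, Equiv.Perm.one_apply, zero_add,
      (Fin.castAdd_injective p i).eq_iff] at h2
    have h3 := congrArg Fin.val h2
    rw [Fin.val_zero, Fin.val_one', Nat.mod_eq_of_lt hp1] at h3
    omega
  have hcard : Nat.card H = p := by
    rw [Nat.card_zpowers, orderOf_eq_prime rotFirst_pow_self hc1]
  let F : Equiv.Perm (Fin (p + i)) → MvPolynomial (Option (Fin i)) (k ⧸ Ideal.span {(p : k)}) :=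
    fun g => collapseHom k p i (rename (g⁻¹ : Equiv.Perm _) u)
  have hFc (g : Equiv.Perm (Fin (p + i))) : F (g * c) = F g := by
    have h := collapseHom_rename_rotFirst (k := k)
      (rename ((g * c)⁻¹ : Equiv.Perm (Fin (p + i))) u)
    rw [rename_rename, ← Equiv.Perm.coe_mul, mul_inv_rev, mul_inv_cancel_left] at h
    simp only [F, mul_inv_rev]
    exact h.symm
  have hFH (g h : Equiv.Perm (Fin (p + i))) (hh : h ∈ H) : F (g * h) = F g := by
    obtain ⟨N, rfl⟩ := mem_powers_iff_mem_zpowers.2 hh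
    change F (g * c ^ N) = F g
    induction N with
    | zero => rw [pow_zero, mul_one]
    | succ N ih =>
      rw [pow_succ, ← mul_assoc, hFc]
      exact ih ⟨N, rfl⟩
  have hsum : collapseHom k p i (transfer k (p + i) u : MvPolynomial (Fin (p + i)) k) =
      ∑ g, F g := by
    rw [coe_transfer, map_sum]
    exact Fintype.sum_equiv (Equiv.inv _) _ _ fun g => by
      simp only [F, Equiv.inv_apply, inv_inv]
  rw [hsum, ← (Subgroup.groupEquivQuotientProdSubgroup (s := H)).symm.sum_comp,
    Fintype.sum_prod_type]
  refine Finset.sum_eq_zero fun q _ => ?_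
  have hq (h : H) : F (Subgroup.groupEquivQuotientProdSubgroup.symm (q, h)) =
      F (Subgroup.groupEquivQuotientProdSubgroup.symm (q, (1 : H))) := by
    have hmk (h : H) : QuotientGroup.mk
        (Subgroup.groupEquivQuotientProdSubgroup.symm (q, h) : Equiv.Perm (Fin (p + i))) = q :=
      congrArg Prod.fst (Subgroup.groupEquivQuotientProdSubgroup.apply_symm_apply (q, h))
    have h' := hFH (Subgroup.groupEquivQuotientProdSubgroup.symm (q, (1 : H))) _
      (QuotientGroup.eq.1 ((hmk 1).trans (hmk h).symm))
    rwa [mul_inv_cancel_left] at h'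
  rw [Finset.sum_congr rfl fun h _ => hq h, Finset.sum_const, Finset.card_univ,
    ← Nat.card_eq_fintype_card, hcard, nsmul_eq_mul,
    (CharP.cast_eq_zero_iff (MvPolynomial (Option (Fin i)) (k ⧸ Ideal.span {(p : k)})) p p).2
      dvd_rfl, zero_mul]

end

/-! ### Elementary symmetric polynomials under the collapse, and its kernel -/

section

variable {k : Type*} [CommRing k] {p i : ℕ}

theorem esymm_eq_zero_of_lt {R : Type*} [CommRing R] {n j : ℕ} (h : n < j) :
    esymm (Fin n) R j = 0 := by
  rw [esymm, Finset.powersetCard_eq_empty.2 (by simpa using h), Finset.sum_empty]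

/-- The coefficients of `∏ (T + y_l)` are the elementary symmetric polynomials in the `y_l`. -/
theorem coeff_prod_X_add_C_X {R : Type*} [CommRing R] (i d : ℕ) :
    (∏ l : Fin i, (Polynomial.X + Polynomial.C (X (some l) :
      MvPolynomial (Option (Fin i)) R))).coeff d =
      if d ≤ i then rename some (esymm (Fin i) R (i - d)) else 0 := by
  have hs (j : ℕ) : rename some (esymm (Fin i) R j) =
      (Finset.univ.val.map fun l : Fin i => (X (some l) : MvPolynomial (Option (Fin i)) R)).esymm
        j := by
    rw [rename_eq_aeval, aeval_esymm_eq_multiset_esymm]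
    rfl
  split_ifs with h
  · have := Multiset.prod_X_add_C_coeff
      (Finset.univ.val.map fun l : Fin i => (X (some l) : MvPolynomial (Option (Fin i)) R))
      (k := d) (by simpa using h)
    rw [hs]
    rw [Multiset.map_map, Multiset.card_map, Finset.card_val, Finset.card_univ,
      Fintype.card_fin] at this
    exact this
  · apply Polynomial.coeff_eq_zero_of_natDegree_lt
    refine lt_of_le_of_lt (Polynomial.natDegree_prod_le _ _) (lt_of_le_of_lt ?_ (not_le.1 h))
    refine (Finset.sum_le_card_nsmul _ _ 1 fun l _ => ?_).trans (by simp)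
    exact Polynomial.natDegree_add_C.trans_le Polynomial.natDegree_X_le

theorem coe_idealGen_eq {n j : ℕ} : (idealGen k p n j : MvPolynomial (Fin n) k) =
    if j = 0 then (p : MvPolynomial (Fin n) k)
    else if j ≤ n - p then esymm (Fin n) k j * esymm (Fin n) k p - esymm (Fin n) k (p + j)
    else esymm (Fin n) k j := by
  unfold idealGen
  split_ifs <;> simp [elemSymm]

theorem idealGen_mem {n j : ℕ} (hj : j < p) :
    idealGen k p n j ∈ Ideal.ofList (genList k p n) :=
  Ideal.subset_span (List.mem_map.2 ⟨j, List.mem_range.2 hj, rfl⟩)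

theorem adjoin_elemSymm (n : ℕ) :
    Algebra.adjoin k (Set.range fun j : Fin n => elemSymm k n (j + 1)) = ⊤ := by
  rw [Algebra.adjoin_range_eq_range_aeval]
  exact (AlgHom.range_eq_top _).2 (esymmAlgHom_surjective (R := k) (σ := Fin n) (n := n) (by simp))

/-- The polynomials `w ^ p, e_1(y), …, e_i(y)` are algebraically independent. -/
theorem aeval_pow_esymm_injective (R : Type*) [CommRing R] {q : ℕ} (hq : 0 < q) (i : ℕ) :
    Function.Injective (aeval (R := R) fun o : Option (Fin i) =>
      o.elim ((X none : MvPolynomial (Option (Fin i)) R) ^ q)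
        fun l => rename some (esymm (Fin i) R (l + 1))) := by
  obtain ⟨φ, hφ, hφC, hφX⟩ : ∃ φ : MvPolynomial (Fin i) R →+* MvPolynomial (Fin i) R,
      Function.Injective φ ∧ (∀ a, φ (C a) = C a) ∧
        ∀ l : Fin i, φ (X l) = esymm (Fin i) R (l + 1) :=
    ⟨(aeval fun l : Fin i => esymm (Fin i) R (l + 1) :
      MvPolynomial (Fin i) R →ₐ[R] MvPolynomial (Fin i) R), algebraicIndependent_esymm R i,
      fun a => aeval_C _ _, fun l => aeval_X _ _⟩
  have hC (f : MvPolynomial (Fin i) R) :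
      optionEquivLeft R (Fin i) (rename some f) = Polynomial.C f := by
    induction f using MvPolynomial.induction_on with
    | C a => simp
    | add f g hf hg => simp [hf, hg]
    | mul_X f l hf => simp [hf]
  have key (f : MvPolynomial (Option (Fin i)) R) :
      optionEquivLeft R (Fin i) (aeval (fun o : Option (Fin i) =>
        o.elim ((X none : MvPolynomial (Option (Fin i)) R) ^ q)
          fun l => rename some (esymm (Fin i) R (l + 1))) f) =
      Polynomial.expand _ q ((optionEquivLeft R (Fin i) f).map φ) := by
    induction f using MvPolynomial.induction_on with
    | C a => simp [hφC]
    | add f g hf hg => simp only [map_add, hf, hg, Polynomial.map_add]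
    | mul_X f o hf =>
      rw [map_mul, map_mul, map_mul, hf, Polynomial.map_mul, map_mul, aeval_X]
      congr 1
      cases o with
      | none =>
        rw [Option.elim_none, map_pow, optionEquivLeft_X_none, Polynomial.map_X,
          Polynomial.expand_X]
      | some l =>
        rw [Option.elim_some, hC, optionEquivLeft_X_some, Polynomial.map_C, Polynomial.expand_C]
        rw [hφX]
  intro f g hfg
  apply (optionEquivLeft R (Fin i)).injective
  apply Polynomial.map_injective φ hφ
  apply Polynomial.expand_injective hq
  rw [← key, ← key, hfg]

/-- The homomorphism `k[w, y_1, …, y_i] → k[e_1, …, e_n]` with `w ↦ e_p` and `y_l ↦ e_l`. -/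
noncomputable def evalElemSymm (k : Type*) [CommRing k] (p i : ℕ) :
    MvPolynomial (Option (Fin i)) k →ₐ[k] SymmRing k (p + i) :=
  aeval fun o => o.elim (elemSymm k (p + i) p) fun l => elemSymm k (p + i) (l + 1)

/-- Modulo the ideal, `e_{p+j}` becomes `e_j e_p` and `e_{i+1}, …, e_{p-1}` vanish, so every
invariant is congruent to a polynomial in `e_1, …, e_i, e_p`. -/
theorem exists_sub_evalElemSymm_mem (hip : i < p) (f : SymmRing k (p + i)) :
    ∃ P, f - evalElemSymm k p i P ∈ Ideal.ofList (genList k p (p + i)) := by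
  set I := Ideal.ofList (genList k p (p + i))
  let B : Subalgebra k (SymmRing k (p + i)) :=
    ((Ideal.Quotient.mkₐ k I).comp (evalElemSymm k p i)).range.comap (Ideal.Quotient.mkₐ k I)
  have hB (f : SymmRing k (p + i)) : f ∈ B ↔ ∃ P, f - evalElemSymm k p i P ∈ I := by
    change (∃ P, Ideal.Quotient.mk I (evalElemSymm k p i P) = Ideal.Quotient.mk I f) ↔ _
    simp only [eq_comm, Ideal.Quotient.eq]
  have hgen (j : Fin (p + i)) : elemSymm k (p + i) (j + 1) ∈ B := by
    rw [hB]
    obtain ⟨j, hj⟩ := j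
    dsimp only
    rcases lt_or_ge j i with h | h
    · exact ⟨X (some ⟨j, h⟩), by simp [evalElemSymm]⟩
    rcases lt_trichotomy (j + 1) p with h' | h' | h'
    · have := idealGen_mem (k := k) (n := p + i) h'
      rw [idealGen, if_neg (by omega), if_neg (by omega)] at this
      exact ⟨0, by simpa using this⟩
    · exact ⟨X none, by simp [evalElemSymm, h']⟩
    · have := idealGen_mem (k := k) (n := p + i) (by omega : j + 1 - p < p)
      rw [idealGen, if_neg (by omega), if_pos (by omega), show p + (j + 1 - p) = j + 1 by omega]
        at this
      refine ⟨X (some ⟨j - p, by omega⟩) * X none, ?_⟩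
      rw [← neg_mem_iff, neg_sub]
      simpa [evalElemSymm, show j - p + 1 = j + 1 - p by omega] using this
  have : (⊤ : Subalgebra k (SymmRing k (p + i))) ≤ B := by
    rw [← adjoin_elemSymm, Algebra.adjoin_le_iff]
    rintro _ ⟨j, rfl⟩
    exact hgen j
  exact (hB f).1 (this Algebra.mem_top)

variable [Fact p.Prime]

/-- The image of the elementary symmetric polynomial `e_j`, read off from
`(T + w) ^ p * ∏ (T + y_l) = (T ^ p + w ^ p) * ∏ (T + y_l)`. -/
theorem collapseHom_esymm (hp : ¬ IsUnit (p : k)) {j : ℕ} (hj : j ≤ p + i) :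
    collapseHom k p i (esymm (Fin (p + i)) k j) =
      rename some (esymm (Fin i) (k ⧸ Ideal.span {(p : k)}) j) +
        if p ≤ j then X none ^ p * rename some (esymm (Fin i) (k ⧸ Ideal.span {(p : k)}) (j - p))
        else 0 := by
  have := charP_quotient hp
  set κ := k ⧸ Ideal.span {(p : k)}
  let x : Fin (p + i) → MvPolynomial (Option (Fin i)) κ := fun a => X (collapse p i a)
  have h1 : collapseHom k p i (esymm (Fin (p + i)) k j) = (Finset.univ.val.map x).esymm j := by
    rw [← aeval_esymm_eq_multiset_esymm (Fin (p + i)) κ]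
    simp only [collapseHom, RingHom.comp_apply, map_esymm, AlgHom.toRingHom_eq_coe,
      RingHom.coe_coe, rename_eq_aeval]
    rfl
  have h2 := Multiset.prod_X_add_C_coeff (Finset.univ.val.map x) (k := p + i - j) (by simp)
  have h3 : (Multiset.map (fun r => Polynomial.X + Polynomial.C r) (Finset.univ.val.map x)).prod =
      (Polynomial.X ^ p + Polynomial.C (X none ^ p)) *
        ∏ l : Fin i, (Polynomial.X + Polynomial.C (X (some l))) := by
    rw [Multiset.map_map]
    change ∏ a, (Polynomial.X + Polynomial.C (x a)) = _
    rw [Fin.prod_univ_add]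
    simp [x, add_pow_char]
  rw [h3, add_mul, Polynomial.coeff_add, Polynomial.coeff_X_pow_mul', Polynomial.coeff_C_mul,
    coeff_prod_X_add_C_X, coeff_prod_X_add_C_X, Multiset.card_map, Finset.card_val,
    Finset.card_univ, Fintype.card_fin, Nat.sub_sub_self hj] at h2
  rw [h1, ← h2]
  congr 1
  · by_cases h : j ≤ i
    · rw [if_pos (by omega), if_pos (by omega), show i - (p + i - j - p) = j by omega]
    · rw [if_neg (by omega), esymm_eq_zero_of_lt (by omega), map_zero]
  · by_cases h : p ≤ j
    · rw [if_pos h, if_pos (by omega), show i - (p + i - j) = j - p by omega]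
    · rw [if_neg h, if_neg (by omega), mul_zero]

theorem collapseHom_esymm_self (hip : i < p) (hp : ¬ IsUnit (p : k)) :
    collapseHom k p i (esymm (Fin (p + i)) k p) = X none ^ p := by
  rw [collapseHom_esymm hp (by omega), esymm_eq_zero_of_lt hip]
  simp [esymm_zero]

theorem collapseHom_idealGen (hip : i < p) (hp : ¬ IsUnit (p : k)) {j : ℕ} (hj : j < p) :
    collapseHom k p i (idealGen k p (p + i) j : MvPolynomial (Fin (p + i)) k) = 0 := by
  have := charP_quotient hp
  rw [coe_idealGen_eq, Nat.add_sub_cancel_left]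
  split_ifs with h0 hi
  · rw [map_natCast]
    exact (CharP.cast_eq_zero_iff (MvPolynomial (Option (Fin i)) (k ⧸ Ideal.span {(p : k)})) p p).2
      dvd_rfl
  · rw [map_sub, map_mul, collapseHom_esymm_self hip hp, collapseHom_esymm hp (by omega),
      collapseHom_esymm hp (by omega), if_neg (by omega), if_pos (by omega),
      esymm_eq_zero_of_lt (by omega : i < p + j), Nat.add_sub_cancel_left, map_zero]
    ring
  · rw [collapseHom_esymm hp (by omega), if_neg (by omega), esymm_eq_zero_of_lt (by omega)]
    simp

theorem collapseHom_of_mem (hip : i < p) (hp : ¬ IsUnit (p : k)) {f : SymmRing k (p + i)}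
    (hf : f ∈ Ideal.ofList (genList k p (p + i))) :
    collapseHom k p i (f : MvPolynomial (Fin (p + i)) k) = 0 := by
  have h : Ideal.ofList (genList k p (p + i)) ≤ RingHom.ker ((collapseHom k p i).comp
      (SymmRing k (p + i)).val.toRingHom) := by
    refine Ideal.span_le.2 fun x hx => ?_
    obtain ⟨j, hj, rfl⟩ := List.mem_map.1 hx
    exact collapseHom_idealGen hip hp (List.mem_range.1 hj)
  exact h hf

theorem collapseHom_evalElemSymm (hip : i < p) (hp : ¬ IsUnit (p : k))
    (P : MvPolynomial (Option (Fin i)) k) :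
    collapseHom k p i (evalElemSymm k p i P : MvPolynomial (Fin (p + i)) k) =
      aeval (fun o : Option (Fin i) => o.elim (X none ^ p)
        fun l => rename some (esymm (Fin i) (k ⧸ Ideal.span {(p : k)}) (l + 1)))
        (MvPolynomial.map (Ideal.Quotient.mk (Ideal.span {(p : k)})) P) := by
  induction P using MvPolynomial.induction_on with
  | C a => simp [evalElemSymm, collapseHom]
  | add f g hf hg => simp only [map_add, Subalgebra.coe_add, hf, hg]
  | mul_X f o hf =>
    simp only [map_mul, Subalgebra.coe_mul, hf, map_X, aeval_X]
    congr 1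
    cases o with
    | none => simpa [evalElemSymm, elemSymm] using collapseHom_esymm_self hip hp
    | some l =>
      have := collapseHom_esymm (k := k) (i := i) hp (by omega : (l : ℕ) + 1 ≤ p + i)
      rw [if_neg (by omega), add_zero] at this
      simpa [evalElemSymm, elemSymm] using this

/-- An invariant polynomial which vanishes under `collapseHom` lies in the ideal. -/
theorem mem_of_collapseHom_eq_zero (hip : i < p) (hp : ¬ IsUnit (p : k)) {f : SymmRing k (p + i)}
    (hf : collapseHom k p i (f : MvPolynomial (Fin (p + i)) k) = 0) :
    f ∈ Ideal.ofList (genList k p (p + i)) := by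
  obtain ⟨P, hP⟩ := exists_sub_evalElemSymm_mem (k := k) hip f
  rw [← sub_add_cancel f (evalElemSymm k p i P)]
  refine add_mem hP ?_
  have h0 := collapseHom_of_mem hip hp hP
  rw [Subalgebra.coe_sub, map_sub, hf, zero_sub, neg_eq_zero,
    collapseHom_evalElemSymm hip hp] at h0
  have hp0 := (Fact.out : p.Prime).pos
  have hP0 := aeval_pow_esymm_injective _ hp0 i (h0.trans (map_zero _).symm)
  -- `P` vanishes modulo `p`, and `p` itself is the first generator.
  have hdvd : C (p : k) ∣ P := by
    rw [C_dvd_iff_dvd_coeff]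
    intro m
    have := congrArg (coeff m) hP0
    rw [coeff_map, coeff_zero, Ideal.Quotient.eq_zero_iff_mem, Ideal.mem_span_singleton] at this
    exact this
  obtain ⟨Q, rfl⟩ := hdvd
  rw [map_mul]
  apply Ideal.mul_mem_right
  have := idealGen_mem (k := k) (n := p + i) hp0
  simpa [idealGen] using this

/-- The image of the transfer and the ideal generated by the list are both the kernel of
`collapseHom` on the ring of invariants. -/
theorem range_transfer_eq (hip : i < p) (hp : ¬ IsUnit (p : k))
    (hu : ∀ N : ℕ, ¬ p ∣ N → IsUnit (N : k)) :
    LinearMap.range (transfer k (p + i)) = Ideal.ofList (genList k p (p + i)) := by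
  apply le_antisymm
  · rintro _ ⟨u, rfl⟩
    exact mem_of_collapseHom_eq_zero hip hp (collapseHom_transfer hp u)
  · intro f hf
    exact mem_range_transfer_of_collapseHom_eq_zero hip hp hu (collapseHom_of_mem hip hp hf)

end

/-! ### Regularity of the list of generators -/

section

variable {k : Type*} [CommRing k]

/-- Membership in an ideal generated by a constant and some variables is read off from the
coefficients. -/
theorem mem_span_C_union_X {σ : Type*} (a : k) (T : Set σ) (f : MvPolynomial σ k) :
    f ∈ Ideal.span ({C a} ∪ X '' T : Set (MvPolynomial σ k)) ↔
      ∀ m : σ →₀ ℕ, (∀ t ∈ T, m t = 0) → a ∣ coeff m f := by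
  constructor
  · intro hf m hm
    rw [Ideal.span_union, Submodule.mem_sup] at hf
    obtain ⟨y, hy, z, hz, rfl⟩ := hf
    obtain ⟨q, rfl⟩ := Ideal.mem_span_singleton.1 hy
    have hz0 : coeff m z = 0 := by
      by_contra h
      obtain ⟨t, ht, ht'⟩ := mem_ideal_span_X_image.1 hz m (mem_support_iff.2 h)
      exact ht' (hm t ht)
    rw [coeff_add, coeff_C_mul, hz0, add_zero]
    exact dvd_mul_right _ _
  · intro h
    rw [f.as_sum]
    refine Ideal.sum_mem _ fun m _ => ?_
    by_cases hm : ∀ t ∈ T, m t = 0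
    · obtain ⟨c, hc⟩ := h m hm
      rw [hc, ← C_mul_monomial]
      exact Ideal.mul_mem_right _ _ (Ideal.subset_span (Or.inl rfl))
    · push Not at hm
      obtain ⟨t, ht, hmt⟩ := hm
      refine Ideal.span_mono Set.subset_union_right (mem_ideal_span_X_image.2 fun d hd => ?_)
      rw [Finset.mem_singleton.1 (support_monomial_subset hd)]
      exact ⟨t, ht, hmt⟩

/-- A nonzerodivisor of the base ring which is not a unit, followed by distinct variables, is a
regular sequence. -/
theorem isRegular_C_X {σ : Type*} {a : k} (ha : ∀ c, a * c = 0 → c = 0) (hau : ¬ IsUnit a)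
    {N : ℕ} {s : ℕ → σ} (hs : Set.InjOn s (Set.Ico 1 N)) :
    RingTheory.Sequence.IsRegular (MvPolynomial σ k)
      ((List.range N).map fun j => if j = 0 then C a else X (s j)) := by
  have hspan (j : ℕ) (hj : 0 < j) :
      Ideal.ofList ((List.range j).map fun j => if j = 0 then C a else X (s j)) =
        Ideal.span ({C a} ∪ X '' (s '' Set.Ico 1 j) : Set (MvPolynomial σ k)) := by
    unfold Ideal.ofList
    congr 1
    ext f
    simp only [List.mem_map, List.mem_range, Set.mem_ofPred_eq, Set.mem_union,
      Set.mem_singleton_iff, Set.mem_image, Set.mem_Ico, exists_exists_and_eq_and]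
    constructor
    · rintro ⟨l, hl, rfl⟩
      rcases Nat.eq_zero_or_pos l with rfl | h
      · exact Or.inl rfl
      · exact Or.inr ⟨l, ⟨h, hl⟩, (if_neg h.ne').symm⟩
    · rintro (rfl | ⟨l, hl, rfl⟩)
      · exact ⟨0, hj, rfl⟩
      · exact ⟨l, hl.2, if_neg (by omega)⟩
  refine ⟨⟨fun j hj => ?_⟩, fun h => ?_⟩
  · rw [List.length_map, List.length_range] at hj
    rw [isSMulRegular_quotient_iff_mem_of_smul_mem, ← List.map_take, List.take_range,
      Nat.min_eq_left hj.le, List.getElem_map, List.getElem_range]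
    simp only [smul_eq_mul, Ideal.mul_top]
    intro f hf
    rcases Nat.eq_zero_or_pos j with rfl | h0
    · rw [List.range_zero, List.map_nil, Ideal.ofList_nil, Ideal.mem_bot] at hf ⊢
      ext m
      apply ha
      rw [if_pos rfl] at hf
      simpa using congrArg (coeff m) hf
    · rw [hspan j h0, mem_span_C_union_X] at hf ⊢
      intro m hm
      rw [if_neg h0.ne'] at hf
      -- Multiplication by `X (s j)` shifts `m` without touching the earlier variables.
      have := hf (Finsupp.single (s j) 1 + m) ?_
      · rwa [coeff_X_mul] at this
      · rintro t ⟨l, hl, rfl⟩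
        have hne : s j ≠ s l := fun h => by
          have := hs ⟨h0, hj⟩ ⟨hl.1, hl.2.trans hj⟩ h
          exact hl.2.ne' this
        simp [hne, hm (s l) ⟨l, hl, rfl⟩]
  -- The range up to `N + 1` keeps the constant `a` among the generators also for `N = 0`.
  · have h1 : (1 : MvPolynomial σ k) ∈ Ideal.ofList
        ((List.range N).map fun j => if j = 0 then C a else X (s j)) := by
      have : (1 : MvPolynomial σ k) ∈ (⊤ : Ideal (MvPolynomial σ k)) := trivial
      rw [h] at this
      simpa only [smul_eq_mul, Ideal.mul_top] using this
    have h2 := Ideal.span_mono (s := {r | r ∈ (List.range N).map fun j =>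
      if j = 0 then C a else X (s j)}) (t := {C a} ∪ X '' (s '' Set.Ico 1 (N + 1))) ?_ h1
    · rw [mem_span_C_union_X] at h2
      have := h2 0 (by simp)
      rw [coeff_zero_one] at this
      exact hau (isUnit_of_dvd_one this)
    · intro f hf
      obtain ⟨l, hl, rfl⟩ := List.mem_map.1 hf
      rcases Nat.eq_zero_or_pos l with rfl | h
      · exact Or.inl rfl
      · exact Or.inr ⟨s l, ⟨l, ⟨h, by have := List.mem_range.1 hl; omega⟩, rfl⟩,
          (if_neg h.ne').symm⟩

variable {p i : ℕ}

/-- The substitution `X_{p+j} ↦ X_j X_p - X_{p+j}` in the polynomial ring in `p + i` variables,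
where `i < p`. Variable `X_j` has index `j - 1`. -/
noncomputable def shear (k : Type*) [CommRing k] (hip : i < p) :
    MvPolynomial (Fin (p + i)) k →ₐ[k] MvPolynomial (Fin (p + i)) k :=
  aeval (Fin.addCases (fun a => X (Fin.castAdd i a)) fun l =>
    X (Fin.castAdd i ⟨l, l.2.trans hip⟩) * X (Fin.castAdd i ⟨p - 1, by omega⟩) -
      X (Fin.natAdd p l))

theorem shear_comp_shear (hip : i < p) :
    (shear k hip).comp (shear k hip) = AlgHom.id k _ := by
  refine algHom_ext fun x => ?_
  induction x using Fin.addCases with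
  | left a => simp only [shear, AlgHom.comp_apply, aeval_X, Fin.addCases_left, AlgHom.id_apply]
  | right l =>
    simp only [shear, AlgHom.comp_apply, aeval_X, Fin.addCases_right, Fin.addCases_left, map_sub,
      map_mul, AlgHom.id_apply, sub_sub_cancel]

/-- The isomorphism from a polynomial ring in `p + i` variables to the ring of invariants under
which the generators in `genList` correspond to `p` and to distinct variables. -/
noncomputable def genEquiv (k : Type*) [CommRing k] (hip : i < p) :
    MvPolynomial (Fin (p + i)) k ≃ₐ[k] SymmRing k (p + i) :=
  (AlgEquiv.ofAlgHom (shear k hip) (shear k hip) (shear_comp_shear hip)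
    (shear_comp_shear hip)).trans (esymmAlgEquiv (Fin (p + i)) k (by simp))

/-- The index of the variable corresponding to the `j`-th generator, for `1 ≤ j < p`. -/
def genIndex (p i : ℕ) [NeZero (p + i)] (j : ℕ) : Fin (p + i) :=
  Fin.ofNat (p + i) (if j ≤ i then p + (j - 1) else j - 1)

theorem esymmAlgEquiv_X {n : ℕ} (a : Fin n) :
    esymmAlgEquiv (Fin n) k (by simp) (X a) = elemSymm k n (a + 1) := by
  change esymmAlgHom (Fin n) k n (X a) = _
  rw [esymmAlgHom, aeval_X]
  rfl

theorem genEquiv_gen [NeZero (p + i)] (hip : i < p) {j : ℕ} (hj : j < p) :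
    genEquiv k hip (if j = 0 then C (p : k) else X (genIndex p i j)) = idealGen k p (p + i) j := by
  rw [idealGen, Nat.add_sub_cancel_left]
  split_ifs with h0 hi
  · rw [map_natCast, map_natCast]
  · have : genIndex p i j = Fin.natAdd p ⟨j - 1, by omega⟩ := by
      ext
      simp only [genIndex, if_pos hi, Fin.val_ofNat, Fin.val_natAdd]
      exact Nat.mod_eq_of_lt (by omega)
    rw [this]
    simp only [genEquiv, AlgEquiv.trans_apply, AlgEquiv.ofAlgHom_apply, shear, aeval_X,
      Fin.addCases_right, map_sub, map_mul, esymmAlgEquiv_X, Fin.val_castAdd, Fin.val_natAdd]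
    rw [show j - 1 + 1 = j by omega, show p - 1 + 1 = p by omega,
      show p + (j - 1) + 1 = p + j by omega]
  · have : genIndex p i j = Fin.castAdd i ⟨j - 1, by omega⟩ := by
      ext
      simp only [genIndex, if_neg hi, Fin.val_ofNat, Fin.val_castAdd]
      exact Nat.mod_eq_of_lt (by omega)
    rw [this]
    simp only [genEquiv, AlgEquiv.trans_apply, AlgEquiv.ofAlgHom_apply, shear, aeval_X,
      Fin.addCases_left, esymmAlgEquiv_X, Fin.val_castAdd]
    congr 1
    omega

theorem genIndex_injOn [NeZero (p + i)] :
    Set.InjOn (genIndex p i) (Set.Ico 1 p) := by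
  rintro a ⟨ha, ha'⟩ b ⟨hb, hb'⟩ h
  have h := congrArg Fin.val h
  simp only [genIndex, Fin.val_ofNat] at h
  rw [Nat.mod_eq_of_lt (by split_ifs <;> omega), Nat.mod_eq_of_lt (by split_ifs <;> omega)] at h
  split_ifs at h <;> omega

theorem isRegular_genList (hip : i < p) (ha : ∀ c, (p : k) * c = 0 → c = 0)
    (hau : ¬ IsUnit (p : k)) :
    RingTheory.Sequence.IsRegular (SymmRing k (p + i)) (genList k p (p + i)) := by
  have : NeZero (p + i) := ⟨by omega⟩
  refine (AddEquiv.isRegular_congr (e := (genEquiv k hip).toAddEquiv) ?_).1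
    (isRegular_C_X ha hau genIndex_injOn)
  rw [genList, List.forall₂_map_left_iff, List.forall₂_map_right_iff, List.forall₂_same]
  intro j hj x
  rw [← genEquiv_gen hip (List.mem_range.1 hj)]
  exact map_mul (genEquiv k hip) _ _

theorem idealGen_ne_zero (hip : i < p) (hp : (p : k) ≠ 0) {j : ℕ} (hj : j < p) :
    idealGen k p (p + i) j ≠ 0 := by
  have : NeZero (p + i) := ⟨by omega⟩
  have : Nontrivial k := ⟨⟨_, _, hp⟩⟩
  rw [← genEquiv_gen hip hj, ne_eq, map_eq_zero_iff _ (genEquiv k hip).injective]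
  split_ifs
  · rwa [C_eq_zero]
  · exact X_ne_zero _

theorem isHomogeneous_esymm (n j : ℕ) : (esymm (Fin n) k j).IsHomogeneous j := by
  rw [esymm_eq_sum_monomial]
  refine IsHomogeneous.sum _ _ _ fun t ht => ?_
  apply isHomogeneous_monomial
  rw [← (Finset.mem_powersetCard.1 ht).2]
  simp [map_sum, Finsupp.degree_single]

end

/-! ### The ring `ℤ_(p)` -/

section

variable (p : ℕ) [Fact p.Prime]

theorem isUnit_natCast_zLocal_iff (N : ℕ) : IsUnit (N : ZLocal p) ↔ ¬ p ∣ N := by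
  have h := IsLocalization.AtPrime.isUnit_to_map_iff (ZLocal p) (Ideal.span {(p : ℤ)}) (N : ℤ)
  rw [map_natCast] at h
  rw [h, Ideal.mem_primeCompl_iff, Ideal.mem_span_singleton, Int.natCast_dvd_natCast]

theorem algebraMap_zLocal_injective : Function.Injective (algebraMap ℤ (ZLocal p)) :=
  IsLocalization.injective _ (Ideal.primeCompl_le_nonZeroDivisors (Ideal.span {(p : ℤ)}))

instance isDomain_zLocal : IsDomain (ZLocal p) :=
  IsLocalization.isDomain_localization
    (Ideal.primeCompl_le_nonZeroDivisors (Ideal.span {(p : ℤ)}))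

instance charZero_zLocal : CharZero (ZLocal p) :=
  charZero_of_injective_algebraMap (algebraMap_zLocal_injective p)

end

/-- The cofixed space of `ℤ_(p)[x_1, …, x_n]` for `p ≤ n < 2p`. Degrees are taken in
`ℤ_(p)[x_1, …, x_n]` with `deg x_j = 1`. -/
theorem theorem1p1 (p n : ℕ) [Fact p.Prime] (hpn : p ≤ n) (hn : n < 2 * p) :
    Nonempty (CofixedSpace (ZLocal p) n ≃ₗ[SymmRing (ZLocal p) n]
        Ideal.ofList (genList (ZLocal p) p n)) ∧
      LinearMap.range (transfer (ZLocal p) n) = Ideal.ofList (genList (ZLocal p) p n) ∧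
      RingTheory.Sequence.IsRegular (SymmRing (ZLocal p) n) (genList (ZLocal p) p n) ∧
      ∀ j < p, ∃ d : ℕ, d ≡ j [MOD p] ∧ idealGen (ZLocal p) p n j ≠ 0 ∧
        (idealGen (ZLocal p) p n j : MvPolynomial (Fin n) (ZLocal p)).IsHomogeneous d := by
  obtain ⟨i, rfl⟩ := Nat.exists_eq_add_of_le hpn
  have hip : i < p := by omega
  have hp : ¬ IsUnit (p : ZLocal p) := fun h => (isUnit_natCast_zLocal_iff p p).1 h dvd_rfl
  have hp0 : (p : ZLocal p) ≠ 0 := Nat.cast_ne_zero.2 (Fact.out : p.Prime).ne_zero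
  have hrange := range_transfer_eq (k := ZLocal p) hip hp
    fun N hN => (isUnit_natCast_zLocal_iff p N).2 hN
  refine ⟨⟨?_⟩, hrange, isRegular_genList hip
    (fun c hc => (mul_eq_zero.1 hc).resolve_left hp0) hp, fun j hj => ?_⟩
  · exact ((Submodule.quotEquivOfEq _ _ ker_transfer.symm).trans
      (transfer (ZLocal p) (p + i)).quotKerEquivRange).trans (LinearEquiv.ofEq _ _ hrange)
  · refine ⟨if j = 0 then 0 else if j ≤ i then p + j else j, ?_, idealGen_ne_zero hip hp0 hj, ?_⟩
    · split_ifs with h0 hi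
      · rw [h0]
      · exact Nat.add_mod_left p j
      · rfl
    · rw [coe_idealGen_eq, Nat.add_sub_cancel_left]
      split_ifs with h0 hi
      · rw [← map_natCast C]
        exact isHomogeneous_C _ _
      · rw [add_comm p j]
        exact ((isHomogeneous_esymm _ _).mul (isHomogeneous_esymm _ _)).sub
          (isHomogeneous_esymm _ _)
      · exact isHomogeneous_esymm _ _
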